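/- Let $K$ be an algebraically closed field of characteristic $0$. An algebraic ring over $K$ is an affine algebraic variety $A$ over $K$ (not necessarily irreducible or connected), equipped with two regular maps $A \times A \to A$, addition and multiplication, that make $A$ into an associative ring with identity (not necessarily commutative) and for which the map $x \mapsto -x$ is also regular. An isomorphism of algebraic rings is a ring isomorphism (preserving the identity) that is also an isomorphism of varieties. A finite-dimensional associative unital $K$-algebra is regarded as an algebraic ring through its structure of affine space, and a direct sum of algebraic rings carries the structure of the product variety. Proposition. Every algebraic ring $A$ over $K$ virtually comes from an algebra. That is, there are a finite-dimensional $K$-algebra $S$ and a finite algebraic ring $C$ such that $A \simeq S \oplus C$ as algebraic rings. -/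

import Mathlib

universe u v w

/-- The evaluation at the point `x`, as a homomorphism of `K`-algebras from an algebra of `K`-valued
functions on `X` to `K`. -/
def evalAt {K : Type u} [Field K] {X : Type v} (O : Subalgebra K (X → K)) (x : X) : O →ₐ[K] K :=
  (Pi.evalAlgHom K (fun _ : X => K) x).comp O.val

/-- The structure of an affine algebraic variety on a set `X` of points, over a field `K` that is
meant to be algebraically closed: a finitely generated `K`-algebra `regular` of `K`-valued functions
on `X` (the regular functions) such that each `K`-algebra homomorphism `regular → K` is the
evaluation at exactly one point of `X`. Choosing generators identifies `X` with a Zariski closed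
subset of some `K ^ n`, and `regular` with the restrictions of polynomials. Varieties are not assumed
to be irreducible. -/
structure AffineVariety (K : Type u) [Field K] (X : Type v) where
  regular : Subalgebra K (X → K)
  regular_fg : regular.FG
  evalAt_bijective : Function.Bijective (evalAt regular)

namespace AffineVariety

/-- A map between affine varieties is regular if it pulls regular functions back to regular
functions. -/
def IsRegularMap {K : Type u} [Field K] {X : Type v} {Y : Type w}
    (V : AffineVariety K X) (W : AffineVariety K Y) (φ : X → Y) : Prop :=
  ∀ f ∈ W.regular, f ∘ φ ∈ V.regular

/-- Composition with `φ`, as a homomorphism of algebras of functions. -/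
def pullback (K : Type u) [Field K] {X : Type v} {Y : Type w} (φ : X → Y) :
    (Y → K) →ₐ[K] (X → K) where
  toFun f := f ∘ φ
  map_one' := rfl
  map_mul' _ _ := rfl
  map_zero' := rfl
  map_add' _ _ := rfl
  commutes' _ := rfl

/-- The product of two affine varieties: its regular functions are the finite sums of products
`f x * g y` of regular functions `f` and `g` on the factors. -/
def prod {K : Type u} [Field K] {X : Type v} {Y : Type w}
    (V : AffineVariety K X) (W : AffineVariety K Y) : AffineVariety K (X × Y) where
  regular := V.regular.map (pullback K Prod.fst) ⊔ W.regular.map (pullback K Prod.snd)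
  regular_fg := (V.regular_fg.map _).sup (W.regular_fg.map _)
  evalAt_bijective := by
    have hle1 : V.regular.map (pullback K Prod.fst) ≤
        V.regular.map (pullback K Prod.fst) ⊔ W.regular.map (pullback K (Prod.snd (α := X))) :=
      le_sup_left
    have hle2 : W.regular.map (pullback K Prod.snd) ≤
        V.regular.map (pullback K (Prod.fst (β := Y))) ⊔ W.regular.map (pullback K Prod.snd) :=
      le_sup_right
    have h1 : ∀ f ∈ V.regular, pullback K Prod.fst f ∈ V.regular.map (pullback K Prod.fst) ⊔
        W.regular.map (pullback K (Prod.snd (α := X) (β := Y))) :=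
      fun f hf => hle1 ⟨f, hf, rfl⟩
    have h2 : ∀ g ∈ W.regular, pullback K Prod.snd g ∈
        V.regular.map (pullback K (Prod.fst (α := X) (β := Y))) ⊔
        W.regular.map (pullback K Prod.snd) :=
      fun f hf => hle2 ⟨f, hf, rfl⟩
    constructor
    · rintro ⟨x, y⟩ ⟨x', y'⟩ h
      refine Prod.ext (V.evalAt_bijective.1 ?_) (W.evalAt_bijective.1 ?_)
      · ext f
        exact DFunLike.congr_fun h ⟨_, h1 f.1 f.2⟩
      · ext g
        exact DFunLike.congr_fun h ⟨_, h2 g.1 g.2⟩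
    · intro φ
      obtain ⟨x, hx⟩ := V.evalAt_bijective.2 (φ.comp
        (((pullback K Prod.fst).comp V.regular.val).codRestrict _ fun f => h1 f.1 f.2))
      obtain ⟨y, hy⟩ := W.evalAt_bijective.2 (φ.comp
        (((pullback K Prod.snd).comp W.regular.val).codRestrict _ fun f => h2 f.1 f.2))
      refine ⟨(x, y), ?_⟩
      have key : V.regular.map (pullback K Prod.fst) ⊔ W.regular.map (pullback K Prod.snd) ≤
          (AlgHom.equalizer (evalAt (V.regular.map (pullback K Prod.fst) ⊔
            W.regular.map (pullback K Prod.snd)) (x, y)) φ).map (Subalgebra.val _) := by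
        refine sup_le ?_ ?_
        · rintro _ ⟨f, hf, rfl⟩
          exact ⟨⟨_, h1 f hf⟩, (AlgHom.mem_equalizer _ _ _).2 (DFunLike.congr_fun hx ⟨f, hf⟩), rfl⟩
        · rintro _ ⟨f, hf, rfl⟩
          exact ⟨⟨_, h2 f hf⟩, (AlgHom.mem_equalizer _ _ _).2 (DFunLike.congr_fun hy ⟨f, hf⟩), rfl⟩
      ext ⟨f, hf⟩
      obtain ⟨⟨g, hg⟩, hgφ, rfl⟩ := key hf
      exact hgφ

/-- A finite-dimensional vector space as an affine space: its regular functions are the polynomial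
functions, that is, the algebra generated by the linear forms. -/
def ofFiniteDimensional (K : Type u) [Field K] (S : Type v) [AddCommGroup S] [Module K S]
    [FiniteDimensional K S] : AffineVariety K S where
  regular := Algebra.adjoin K (Set.range fun ℓ : Module.Dual K S => (ℓ : S → K))
  regular_fg := by
    let b := Module.finBasis K S
    refine Subalgebra.fg_def.2 ⟨Set.range fun i => (b.coord i : S → K), Set.finite_range _,
      le_antisymm (Algebra.adjoin_mono ?_) (Algebra.adjoin_le ?_)⟩
    · rintro _ ⟨i, rfl⟩
      exact ⟨b.coord i, rfl⟩
    · rintro _ ⟨ℓ, rfl⟩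
      have h : (ℓ : S → K) = ∑ i, ℓ (b i) • (b.coord i : S → K) := by
        funext x
        conv_lhs => rw [← b.sum_repr x]
        simp only [map_sum, map_smul, Finset.sum_apply, Pi.smul_apply, smul_eq_mul,
          Module.Basis.coord_apply]
        exact Finset.sum_congr rfl fun i _ => mul_comm _ _
      change (ℓ : S → K) ∈ _
      rw [h]
      exact sum_mem fun i _ => Subalgebra.smul_mem _ (Algebra.subset_adjoin (Set.mem_range_self i)) _
  evalAt_bijective := by
    have hmem : ∀ ℓ : Module.Dual K S, (ℓ : S → K) ∈
        Algebra.adjoin K (Set.range fun ℓ : Module.Dual K S => (ℓ : S → K)) :=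
      fun ℓ => Algebra.subset_adjoin ⟨ℓ, rfl⟩
    constructor
    · intro x y h
      refine (Module.evalEquiv K S).injective (LinearMap.ext fun ℓ => ?_)
      exact DFunLike.congr_fun h ⟨_, hmem ℓ⟩
    · intro φ
      let θ : Module.Dual K (Module.Dual K S) :=
        { toFun := fun ℓ => φ ⟨_, hmem ℓ⟩
          map_add' := fun ℓ ℓ' => map_add φ ⟨_, hmem ℓ⟩ ⟨_, hmem ℓ'⟩
          map_smul' := fun c ℓ => map_smul φ c ⟨_, hmem ℓ⟩ }
      refine ⟨(Module.evalEquiv K S).symm θ, AlgHom.adjoin_ext ?_⟩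
      rintro _ ⟨ℓ, rfl⟩
      exact Module.apply_evalEquiv_symm_apply (R := K) (M := S) ℓ θ

/-- The additive and multiplicative operations of the ring `A` are regular maps: together with the
axioms of a ring with identity, this says that `A` is an algebraic ring. -/
structure IsAlgebraicRing {K : Type u} [Field K] {A : Type v} [Ring A] (V : AffineVariety K A) :
    Prop where
  isRegularMap_add : (V.prod V).IsRegularMap V fun p => p.1 + p.2
  isRegularMap_neg : V.IsRegularMap V fun x => -x
  isRegularMap_mul : (V.prod V).IsRegularMap V fun p => p.1 * p.2

/-- Two algebraic rings are isomorphic: there is an isomorphism of rings (with identity) which is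
also an isomorphism of varieties. -/
def RingIsomorphic {K : Type u} [Field K] {A : Type v} [Ring A] {B : Type w} [Ring B]
    (V : AffineVariety K A) (W : AffineVariety K B) : Prop :=
  ∃ e : A ≃+* B, V.IsRegularMap W e ∧ W.IsRegularMap V e.symm

/-- The algebraic ring `A` comes from an algebra: it is isomorphic, as an algebraic ring, to a
finite-dimensional (associative, unital) `K`-algebra. -/
def ComesFromAlgebra {K : Type u} [Field K] {A : Type v} [Ring A] (V : AffineVariety K A) : Prop :=
  ∃ (S : Type v) (_ : Ring S) (_ : Algebra K S) (_ : FiniteDimensional K S),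
    V.RingIsomorphic (ofFiniteDimensional K S)

/-- The algebraic ring `A` virtually comes from an algebra: it is isomorphic, as an algebraic ring,
to a direct sum `A' ⊕ B` of algebraic rings, where `A'` comes from an algebra and `B` is finite. -/
def VirtuallyComesFromAlgebra {K : Type u} [Field K] {A : Type v} [Ring A]
    (V : AffineVariety K A) : Prop :=
  ∃ (A' : Type v) (_ : Ring A') (V' : AffineVariety K A')
    (B : Type v) (_ : Ring B) (W : AffineVariety K B),
    V'.IsAlgebraicRing ∧ W.IsAlgebraicRing ∧ V'.ComesFromAlgebra ∧ Finite B ∧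
      V.RingIsomorphic (V'.prod W)

end AffineVariety

open Polynomial

namespace AffineVariety

section Regular

variable {K : Type u} [Field K] {X Y Z : Type*} {VX : AffineVariety K X}
  {VY : AffineVariety K Y} {VZ : AffineVariety K Z}

theorem IsRegularMap.id : VX.IsRegularMap VX (fun x => x) := fun _ hf => hf

theorem IsRegularMap.comp {ψ : Y → Z} {φ : X → Y} (hψ : VY.IsRegularMap VZ ψ)
    (hφ : VX.IsRegularMap VY φ) : VX.IsRegularMap VZ (fun x => ψ (φ x)) :=
  fun f hf => hφ _ (hψ f hf)

theorem const_mem (c : K) : (fun _ => c) ∈ VX.regular := VX.regular.algebraMap_mem c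

theorem IsRegularMap.const (y : Y) : VX.IsRegularMap VY (fun _ => y) :=
  fun f _ => const_mem (f y)

theorem IsRegularMap.fst : (VX.prod VY).IsRegularMap VX Prod.fst :=
  fun f hf => (le_sup_left : _ ≤ (VX.prod VY).regular) ⟨f, hf, rfl⟩

theorem IsRegularMap.snd : (VX.prod VY).IsRegularMap VY Prod.snd :=
  fun f hf => (le_sup_right : _ ≤ (VX.prod VY).regular) ⟨f, hf, rfl⟩

theorem prod_regular_le {T : Subalgebra K (X × Y → K)}
    (h₁ : ∀ f ∈ VX.regular, (fun p => f p.1) ∈ T) (h₂ : ∀ f ∈ VY.regular, (fun p => f p.2) ∈ T) :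
    (VX.prod VY).regular ≤ T := by
  refine sup_le ?_ ?_
  · rintro _ ⟨f, hf, rfl⟩
    exact h₁ f hf
  · rintro _ ⟨f, hf, rfl⟩
    exact h₂ f hf

theorem IsRegularMap.prodMk {φ : X → Y} {ψ : X → Z} (hφ : VX.IsRegularMap VY φ)
    (hψ : VX.IsRegularMap VZ ψ) : VX.IsRegularMap (VY.prod VZ) (fun x => (φ x, ψ x)) := by
  have h : (VY.prod VZ).regular ≤ VX.regular.comap (pullback K fun x => (φ x, ψ x)) :=
    prod_regular_le (fun f hf => hφ f hf) (fun f hf => hψ f hf)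
  exact fun f hf => h hf

/-- A regular map into a variety can be tested on generators of its algebra of functions. -/
theorem isRegularMap_of_adjoin {φ : X → Y} {s : Set (Y → K)}
    (hs : VY.regular = Algebra.adjoin K s) (h : ∀ f ∈ s, f ∘ φ ∈ VX.regular) :
    VX.IsRegularMap VY φ := by
  have h' : VY.regular ≤ VX.regular.comap (pullback K φ) := by
    rw [hs]
    exact Algebra.adjoin_le h
  exact fun f hf => h' hf

/-- The restrictions to the slices `X × {y}` of a regular function on a product span a
finite-dimensional space of regular functions. -/
theorem exists_fg_slices {F : X × Y → K} (hF : F ∈ (VX.prod VY).regular) :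
    ∃ M : Submodule K (X → K), M.FG ∧ M ≤ Subalgebra.toSubmodule VX.regular ∧
      ∀ y, (fun x => F (x, y)) ∈ M := by
  let T : Subalgebra K (X × Y → K) :=
    { carrier := {F | ∃ M : Submodule K (X → K), M.FG ∧
        M ≤ Subalgebra.toSubmodule VX.regular ∧ ∀ y, (fun x => F (x, y)) ∈ M}
      mul_mem' := by
        rintro F G ⟨M, hM, hM', hF⟩ ⟨N, hN, hN', hG⟩
        refine ⟨M * N, hM.mul hN, ?_, fun y => Submodule.mul_mem_mul (hF y) (hG y)⟩
        exact Submodule.mul_le.2 fun f hf g hg => VX.regular.mul_mem (hM' hf) (hN' hg)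
      add_mem' := by
        rintro F G ⟨M, hM, hM', hF⟩ ⟨N, hN, hN', hG⟩
        exact ⟨M ⊔ N, hM.sup hN, sup_le hM' hN', fun y => Submodule.add_mem_sup (hF y) (hG y)⟩
      algebraMap_mem' := fun c =>
        ⟨Submodule.span K {fun _ => c}, Submodule.fg_span_singleton _,
          (Submodule.span_singleton_le_iff_mem _ _).2 (const_mem c),
          fun _ => Submodule.mem_span_singleton_self _⟩ }
  refine prod_regular_le (T := T) (fun f hf => ?_) (fun f hf => ?_) hF
  · exact ⟨Submodule.span K {f}, Submodule.fg_span_singleton _,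
      (Submodule.span_singleton_le_iff_mem _ _).2 hf, fun _ => Submodule.mem_span_singleton_self _⟩
  · refine ⟨Submodule.span K {1}, Submodule.fg_span_singleton _,
      (Submodule.span_singleton_le_iff_mem _ _).2 VX.regular.one_mem,
      fun y => Submodule.mem_span_singleton.2 ⟨f y, ?_⟩⟩
    ext x
    simp

theorem eq_of_forall_regular {x y : X} (h : ∀ f ∈ VX.regular, f x = f y) : x = y :=
  VX.evalAt_bijective.1 (AlgHom.ext fun f => h f.1 f.2)

end Regular

section LinearAlgebra

variable {K : Type u} [Field K] [IsAlgClosed K] {M : Type*} [AddCommGroup M] [Module K M]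
  [FiniteDimensional K M]

theorem _root_.Module.End.exists_common_eigenvector {ι : Type*} (T : ι → Module.End K M)
    (hT : ∀ i j, Commute (T i) (T j)) (i₀ : ι) {μ : K} (hμ : (T i₀).HasEigenvalue μ) :
    ∃ v : M, v ≠ 0 ∧ T i₀ v = μ • v ∧ ∀ i, ∃ c : K, T i v = c • v := by
  have hinv : ∀ i j c, ∀ v ∈ (T i).eigenspace c, T j v ∈ (T i).eigenspace c :=
    fun i j c => Module.End.mapsTo_genEigenspace_of_comm (hT i j) c 1
  let P : Set (Submodule K M) :=
    {N | N ≠ ⊥ ∧ N ≤ (T i₀).eigenspace μ ∧ ∀ i, ∀ v ∈ N, T i v ∈ N}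
  have hP : P.Nonempty := ⟨(T i₀).eigenspace μ, hμ, le_rfl, fun j => hinv i₀ j μ⟩
  obtain ⟨N, ⟨hN0, hNμ, hNT⟩, hmin⟩ := wellFounded_lt.has_min P hP
  obtain ⟨v, hvN, hv0⟩ := N.exists_mem_ne_zero_of_ne_bot hN0
  refine ⟨v, hv0, Module.End.mem_eigenspace_iff.1 (hNμ hvN), fun i => ?_⟩
  have : Nontrivial N := Submodule.nontrivial_iff_ne_bot.2 hN0
  obtain ⟨c, hc⟩ := Module.End.exists_eigenvalue ((T i).restrict (hNT i))
  obtain ⟨w, hw⟩ := hc.exists_hasEigenvector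
  have hw' : T i w = c • (w : M) := congrArg Subtype.val hw.apply_eq_smul
  have hle : N ≤ (T i).eigenspace c := by
    by_contra hle
    refine hmin (N ⊓ (T i).eigenspace c) ⟨?_, inf_le_left.trans hNμ, fun j x hx =>
      ⟨hNT j x hx.1, hinv i j c x hx.2⟩⟩ (inf_lt_left.2 hle)
    refine (Submodule.ne_bot_iff _).2 ⟨w, ⟨w.2, Module.End.mem_eigenspace_iff.2 hw'⟩, ?_⟩
    simpa using hw.2
  exact ⟨c, Module.End.mem_eigenspace_iff.1 (hle hvN)⟩

theorem _root_.Module.End.isNilpotent_sub_one_of_eigenvalue_eq_one (T : Module.End K M)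
    (h : ∀ μ, T.HasEigenvalue μ → μ = 1) : IsNilpotent (T - 1) := by
  have htop := Module.End.iSup_maxGenEigenspace_eq_top T
  have hle : ⨆ μ, T.maxGenEigenspace μ ≤ T.maxGenEigenspace 1 := by
    refine iSup_le fun μ => ?_
    by_cases hμ : μ = 1
    · rw [hμ]
    · have : T.maxGenEigenspace μ = ⊥ := by
        by_contra hne
        exact hμ (h μ (Module.End.HasUnifEigenvalue.lt (k := ⊤) (by simp) hne))
      rw [this]
      exact bot_le
  rw [htop, top_le_iff, Module.End.maxGenEigenspace_eq_genEigenspace_finrank,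
    Module.End.genEigenspace_nat, LinearMap.ker_eq_top] at hle
  exact ⟨_, by simpa using hle⟩

end LinearAlgebra

/-- The iterates of a unipotent operator depend polynomially on the exponent. -/
theorem _root_.Module.End.exists_polynomial_apply_pow {K M : Type*} [Field K] [CharZero K]
    [AddCommGroup M] [Module K M] {T : Module.End K M} (hT : IsNilpotent (T - 1))
    (φ : M →ₗ[K] K) (w : M) : ∃ P : K[X], ∀ n : ℕ, φ ((T ^ n) w) = P.eval (n : K) := by
  obtain ⟨d, hd⟩ := hT
  refine ⟨∑ k ∈ Finset.range d,
    C (φ (((T - 1) ^ k) w)) * (C ((k.factorial : K)⁻¹) * descPochhammer K k), fun n => ?_⟩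
  have hpow : T ^ n = ∑ k ∈ Finset.range d, (n.choose k : K) • (T - 1) ^ k := by
    have h1 : T ^ n = ∑ k ∈ Finset.range (n + 1), (n.choose k : K) • (T - 1) ^ k := by
      conv_lhs => rw [← sub_add_cancel T 1, (Commute.one_right (T - 1)).add_pow]
      refine Finset.sum_congr rfl fun k _ => ?_
      rw [one_pow, mul_one, ← nsmul_eq_mul', Nat.cast_smul_eq_nsmul]
    have h2 : ∑ k ∈ Finset.range (n + 1), (n.choose k : K) • (T - 1) ^ k =
        ∑ k ∈ Finset.range (n + 1 + d), (n.choose k : K) • (T - 1) ^ k := by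
      refine Finset.sum_subset (Finset.range_mono (by omega)) fun k _ hk => ?_
      rw [Nat.choose_eq_zero_of_lt (by simpa using hk), Nat.cast_zero, zero_smul]
    rw [h1, h2]
    refine (Finset.sum_subset (Finset.range_mono (by omega)) fun k _ hk => ?_).symm
    rw [pow_eq_zero_of_le (by simpa using hk) hd, smul_zero]
  rw [hpow, eval_finsetSum, LinearMap.sum_apply, map_sum]
  refine Finset.sum_congr rfl fun k _ => ?_
  rw [LinearMap.smul_apply, map_smul, eval_mul, eval_mul, eval_C, eval_C,
    descPochhammer_eval_eq_descFactorial, Nat.descFactorial_eq_factorial_mul_choose]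
  have : (k.factorial : K) ≠ 0 := Nat.cast_ne_zero.2 k.factorial_ne_zero
  push_cast
  field_simp
  rw [smul_eq_mul, mul_comm]

section Characters

variable {K : Type u} [Field K] {A : Type v} [AddCommGroup A]

theorem _root_.AddChar.linearIndependent_coe :
    LinearIndependent K (fun χ : AddChar A K => (χ : A → K)) :=
  (linearIndependent_monoidHom (Multiplicative A) K).comp
    (AddChar.toMonoidHomEquiv : AddChar A K ≃ _) (Equiv.injective _)

theorem finite_addChar_of_fg {M : Submodule K (A → K)} (hM : M.FG) :
    {χ : AddChar A K | (χ : A → K) ∈ M}.Finite := by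
  have : FiniteDimensional K M := Module.Finite.iff_fg.2 hM
  have h : LinearIndependent K
      (fun χ : {χ : AddChar A K | (χ : A → K) ∈ M} => (⟨χ.1, χ.2⟩ : M)) :=
    LinearIndependent.of_comp M.subtype
      (AddChar.linearIndependent_coe.comp Subtype.val Subtype.val_injective)
  exact Set.finite_coe_iff.1 h.finite

/-- Translation by `a` on functions. -/
def translate (K : Type u) [Field K] {A : Type v} [AddCommGroup A] (a : A) :
    (A → K) →ₗ[K] (A → K) := LinearMap.funLeft K K (· + a)

theorem translate_apply (a : A) (f : A → K) (x : A) : translate K a f x = f (x + a) := rfl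

theorem translate_translate (a b : A) (f : A → K) :
    translate K a (translate K b f) = translate K (a + b) f := by
  ext x
  simp only [translate_apply, add_assoc]

variable {W : Submodule K (A → K)}

theorem restrict_translate_pow_apply
    (hW : ∀ a, ∀ f ∈ W, translate K a f ∈ W) (a : A) (n : ℕ) (f : W) :
    ((((translate K a).restrict (hW a)) ^ n) f : A → K) = translate K (n • a) f := by
  induction n with
  | zero => ext x; simp [translate_apply]
  | succ n ih =>
    rw [pow_succ', Module.End.mul_apply, LinearMap.coe_restrict_apply, ih, translate_translate,
      succ_nsmul']

/-- An eigenvalue of the translation by `a` on a translation-invariant space is the value at `a` of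
a character that belongs to this space. -/
theorem exists_addChar_of_hasEigenvalue [IsAlgClosed K] [FiniteDimensional K W]
    (hW : ∀ a, ∀ f ∈ W, translate K a f ∈ W) {a : A} {μ : K}
    (hμ : Module.End.HasEigenvalue ((translate K a).restrict (hW a)) μ) :
    ∃ χ : AddChar A K, (χ : A → K) ∈ W ∧ χ a = μ := by
  obtain ⟨h, h0, ha, hall⟩ := Module.End.exists_common_eigenvector
    (fun b => (translate K b).restrict (hW b)) (fun b c => by
      refine LinearMap.ext fun f => Subtype.ext ?_
      change translate K b (translate K c f) = translate K c (translate K b f)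
      rw [translate_translate, translate_translate, add_comm]) a hμ
  choose χ hχ using hall
  have key : ∀ x b, h.1 (x + b) = χ b * h.1 x := fun x b =>
    congrFun (congrArg Subtype.val (hχ b)) x
  have hb : ∀ b, h.1 b = χ b * h.1 0 := fun b => by simpa using key 0 b
  have h00 : h.1 0 ≠ 0 := fun h00 => h0 (Subtype.ext (funext fun b => by simp [hb b, h00]))
  refine ⟨{ toFun := χ, map_zero_eq_one' := ?_, map_add_eq_mul' := ?_ }, ?_, ?_⟩
  · have := hb 0
    exact mul_right_cancel₀ h00 (by rw [← this, one_mul])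
  · intro x y
    refine mul_right_cancel₀ h00 ?_
    rw [← hb, key, hb x]
    ring
  · have : χ = (h.1 0)⁻¹ • h.1 := by
      ext b
      rw [Pi.smul_apply, hb b, smul_eq_mul]
      field_simp
    change χ ∈ W
    rw [this]
    exact W.smul_mem _ h.2
  · refine mul_right_cancel₀ h00 ?_
    change χ a * _ = _
    rw [← hb]
    simpa [translate_apply] using congrFun (congrArg Subtype.val ha) 0

theorem exists_polynomial_of_forall_addChar [IsAlgClosed K] [CharZero K] [FiniteDimensional K W]
    (hW : ∀ a, ∀ f ∈ W, translate K a f ∈ W) {a : A}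
    (ha : ∀ χ : AddChar A K, (χ : A → K) ∈ W → χ a = 1)
    {f : A → K} (hf : f ∈ W) :
    ∃ P : K[X], ∀ n : ℕ, f (n • a) = P.eval (n : K) := by
  have hnil := Module.End.isNilpotent_sub_one_of_eigenvalue_eq_one
    ((translate K a).restrict (hW a)) fun μ hμ => by
      obtain ⟨χ, hχ, rfl⟩ := exists_addChar_of_hasEigenvalue hW hμ
      exact ha χ hχ
  obtain ⟨P, hP⟩ := Module.End.exists_polynomial_apply_pow hnil
    ((LinearMap.proj 0).comp W.subtype) ⟨f, hf⟩
  refine ⟨P, fun n => ?_⟩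
  rw [← hP n]
  change _ = (((translate K a).restrict (hW a) ^ n) ⟨f, hf⟩).1 0
  rw [restrict_translate_pow_apply, translate_apply, zero_add]

end Characters

section AlgebraicGroup

variable {K : Type u} [Field K] {A : Type v} [AddCommGroup A] {V : AffineVariety K A}

/-- The regular functions on a commutative algebraic group are generated by a finite-dimensional
translation-invariant space. -/
theorem exists_translation_invariant (hadd : (V.prod V).IsRegularMap V fun p => p.1 + p.2) :
    ∃ W : Submodule K (A → K), W.FG ∧ (∀ a, ∀ f ∈ W, translate K a f ∈ W) ∧
      V.regular = Algebra.adjoin K (W : Set (A → K)) := by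
  obtain ⟨s, hs⟩ := V.regular_fg
  have hsV : ∀ f ∈ s, f ∈ V.regular := fun f hf => hs ▸ Algebra.subset_adjoin hf
  let W : Submodule K (A → K) := ⨆ f ∈ s, Submodule.span K (Set.range fun a => translate K a f)
  have hWf : ∀ f ∈ s, ∃ M : Submodule K (A → K), M.FG ∧ M ≤ Subalgebra.toSubmodule V.regular ∧
      Submodule.span K (Set.range fun a => translate K a f) ≤ M := fun f hf => by
    obtain ⟨M, hM, hMV, h⟩ := exists_fg_slices (hadd f (hsV f hf))
    refine ⟨M, hM, hMV, Submodule.span_le.2 ?_⟩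
    rintro _ ⟨a, rfl⟩
    exact h a
  have htr : ∀ f ∈ s, ∀ a, translate K a f ∈ W := fun f hf a =>
    Submodule.mem_iSup_of_mem f (Submodule.mem_iSup_of_mem hf (Submodule.subset_span ⟨a, rfl⟩))
  refine ⟨W, ?_, fun a => ?_, ?_⟩
  · refine Submodule.fg_biSup _ _ fun f hf => ?_
    obtain ⟨M, hM, -, h⟩ := hWf f hf
    have : FiniteDimensional K M := Module.Finite.iff_fg.2 hM
    exact Module.Finite.iff_fg.1 (Submodule.finiteDimensional_of_le h)
  · change W ≤ W.comap (translate K a)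
    refine iSup₂_le fun f hf => Submodule.span_le.2 ?_
    rintro _ ⟨b, rfl⟩
    change translate K a (translate K b f) ∈ W
    rw [translate_translate]
    exact htr f hf _
  · refine le_antisymm ?_ (Algebra.adjoin_le ?_)
    · rw [← hs]
      refine Algebra.adjoin_mono fun f hf => ?_
      have := htr f hf 0
      rwa [show translate K 0 f = f from funext fun x => by rw [translate_apply, add_zero]] at this
    · refine (iSup₂_le fun f hf => ?_ : W ≤ Subalgebra.toSubmodule V.regular)
      obtain ⟨M, -, h, h'⟩ := hWf f hf
      exact h'.trans h

/-- Finitely many characters of a commutative algebraic group decide which elements are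
unipotent. -/
theorem exists_finite_addChar [IsAlgClosed K] [CharZero K]
    (hadd : (V.prod V).IsRegularMap V fun p => p.1 + p.2) :
    ∃ s : Finset (AddChar A K), (∀ χ ∈ s, (χ : A → K) ∈ V.regular) ∧
      ∀ a, (∀ χ ∈ s, χ a = 1) → ∀ f ∈ V.regular,
        ∃ P : K[X], ∀ n : ℕ, f (n • a) = P.eval (n : K) := by
  obtain ⟨W, hWfg, hW, hgen⟩ := exists_translation_invariant hadd
  have : FiniteDimensional K W := Module.Finite.iff_fg.2 hWfg
  refine ⟨(finite_addChar_of_fg hWfg).toFinset, fun χ hχ => ?_, fun a ha => ?_⟩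
  · rw [hgen]
    exact Algebra.subset_adjoin ((finite_addChar_of_fg hWfg).mem_toFinset.1 hχ)
  · let T : Subalgebra K (A → K) :=
      { carrier := {f | ∃ P : K[X], ∀ n : ℕ, f (n • a) = P.eval (n : K)}
        mul_mem' := by
          rintro f g ⟨P, hP⟩ ⟨Q, hQ⟩
          exact ⟨P * Q, fun n => by simp [hP, hQ]⟩
        add_mem' := by
          rintro f g ⟨P, hP⟩ ⟨Q, hQ⟩
          exact ⟨P + Q, fun n => by simp [hP, hQ]⟩
        algebraMap_mem' := fun c => ⟨C c, fun n => by simp⟩ }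
    have hT : V.regular ≤ T := by
      rw [hgen]
      exact Algebra.adjoin_le fun f hf => exists_polynomial_of_forall_addChar hW
        (fun χ hχ => ha χ ((finite_addChar_of_fg hWfg).mem_toFinset.2 hχ)) hf
    exact fun f hf => hT hf

end AlgebraicGroup

section AlgebraicRing

variable {K : Type u} [Field K] {A : Type v} [Ring A] {V : AffineVariety K A}

/-- The characters of the additive group of an algebraic ring have finite order. -/
theorem IsAlgebraicRing.exists_addChar_pow_eq_one (hV : V.IsAlgebraicRing) {χ : AddChar A K}
    (hχ : (χ : A → K) ∈ V.regular) : ∃ k : ℕ, 0 < k ∧ ∀ a, χ a ^ k = 1 := by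
  obtain ⟨M, hM, -, h⟩ := exists_fg_slices (hV.isRegularMap_mul _ hχ)
  let ψ : ℕ → AddChar A K := fun n => χ.compAddMonoidHom (AddMonoidHom.mulRight (n : A))
  have hψ : ∀ n a, ψ n a = χ a ^ n := fun n a => by
    change χ (a * n) = _
    rw [← nsmul_eq_mul', AddChar.map_nsmul_eq_pow]
  have hmem : ∀ n, ψ n ∈ {χ : AddChar A K | (χ : A → K) ∈ M} := fun n => h n
  obtain ⟨i, -, j, -, hij, hne⟩ := Set.infinite_univ.exists_lt_map_eq_of_mapsTo
    (fun n _ => hmem n) (finite_addChar_of_fg hM)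
  refine ⟨j - i, by omega, fun a => ?_⟩
  have h0 : χ a ^ i ≠ 0 := pow_ne_zero _ (χ.val_isUnit a).ne_zero
  refine mul_left_cancel₀ h0 ?_
  rw [← pow_add, Nat.add_sub_of_le hij.le, mul_one, ← hψ, ← hψ, hne]

/-- Some nonzero integer `m` makes each element unipotent for the addition of an algebraic ring,
and only finitely many elements are killed by `m`. -/
theorem IsAlgebraicRing.exists_unipotent_multiple [IsAlgClosed K] [CharZero K]
    (hV : V.IsAlgebraicRing) : ∃ m : ℕ, 0 < m ∧
      (∀ f ∈ V.regular, ∃ P : K[X], ∀ n : ℕ, f ((n * m : ℕ) : A) = P.eval (n : K)) ∧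
      {c : A | m • c = 0}.Finite := by
  obtain ⟨s, hs, hpoly⟩ := exists_finite_addChar hV.isRegularMap_add
  choose! k hk hk1 using fun χ hχ => hV.exists_addChar_pow_eq_one (hs χ hχ)
  let m := ∏ χ ∈ s, k χ
  have hm : 0 < m := Finset.prod_pos hk
  have hχm : ∀ χ ∈ s, ∀ a, χ a ^ m = 1 := fun χ hχ a => by
    obtain ⟨q, hq⟩ := Finset.dvd_prod_of_mem k hχ
    change χ a ^ (∏ χ ∈ s, k χ) = 1
    rw [hq, pow_mul, hk1 χ hχ, one_pow]
  refine ⟨m, hm, fun f hf => ?_, ?_⟩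
  · obtain ⟨P, hP⟩ := hpoly (m : A)
      (fun χ hχ => by rw [← nsmul_one, AddChar.map_nsmul_eq_pow, hχm χ hχ]) f hf
    exact ⟨P, fun n => by rw [← hP, Nat.cast_mul, nsmul_eq_mul]⟩
  · have hzero : ∀ c : A, m • c = 0 → (∀ χ ∈ s, χ c = 1) → c = 0 := fun c hc hχc => by
      refine V.eq_of_forall_regular fun f hf => ?_
      obtain ⟨P, hP⟩ := hpoly c hχc f hf
      have hP0 : P = C (f 0) := by
        refine Polynomial.eq_of_infinite_eval_eq _ _
          (((Set.infinite_range_of_injective (f := fun n : ℕ => ((n * m : ℕ) : K)) ?_)).mono ?_)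
        · exact Nat.cast_injective.comp fun a b h => Nat.eq_of_mul_eq_mul_right hm h
        · rintro _ ⟨n, rfl⟩
          change P.eval _ = _
          rw [← hP, mul_smul, hc, smul_zero, eval_C]
      have := hP 1
      rwa [hP0, eval_C, one_smul] at this
    have hfin : (Set.univ.pi fun _ : s => {x : K | x ^ m = 1}).Finite := by
      refine Set.Finite.pi fun _ => ?_
      refine (Multiset.finite_toSet (nthRoots m (1 : K))).subset fun x hx => ?_
      exact (mem_nthRoots hm).2 hx
    refine Set.Finite.of_finite_image (f := fun c => fun χ : s => χ.1 c) (hfin.subset ?_) ?_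
    · rintro _ ⟨c, -, rfl⟩ χ -
      exact hχm χ.1 χ.2 c
    · intro c hc d hd hcd
      refine sub_eq_zero.1 (hzero (c - d) ?_ fun χ hχ => ?_)
      · rw [smul_sub, show m • c = 0 from hc, show m • d = 0 from hd, sub_zero]
      · rw [AddChar.map_sub_eq_div, show χ c = χ d from congrFun hcd ⟨χ, hχ⟩,
          div_self (χ.val_isUnit d).ne_zero]

end AlgebraicRing

section Line

variable {K : Type u} [Field K] {X Y : Type*} {VX : AffineVariety K X} {VY : AffineVariety K Y}

/-- The affine line. -/
abbrev line (K : Type u) [Field K] : AffineVariety K K := ofFiniteDimensional K K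

theorem dual_mem_regular {S : Type*} [AddCommGroup S] [Module K S] [FiniteDimensional K S]
    (ℓ : Module.Dual K S) : (ℓ : S → K) ∈ (ofFiniteDimensional K S).regular :=
  Algebra.subset_adjoin ⟨ℓ, rfl⟩

theorem isRegularMap_ofFiniteDimensional {S : Type*} [AddCommGroup S] [Module K S]
    [FiniteDimensional K S] {φ : X → S}
    (h : ∀ ℓ : Module.Dual K S, (fun x => ℓ (φ x)) ∈ VX.regular) :
    VX.IsRegularMap (ofFiniteDimensional K S) φ := by
  refine isRegularMap_of_adjoin rfl ?_
  rintro _ ⟨ℓ, rfl⟩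
  exact h ℓ

theorem isRegularMap_line_iff {φ : X → K} : VX.IsRegularMap (line K) φ ↔ φ ∈ VX.regular := by
  refine ⟨fun h => h _ (dual_mem_regular (LinearMap.id : K →ₗ[K] K)), fun h => ?_⟩
  refine isRegularMap_ofFiniteDimensional fun ℓ => ?_
  have : (fun x => ℓ (φ x)) = ℓ 1 • φ := by
    ext x
    rw [Pi.smul_apply, smul_eq_mul, mul_comm, ← smul_eq_mul, ← map_smul, smul_eq_mul, mul_one]
  rw [this]
  exact VX.regular.smul_mem h _

theorem mem_regular_line_iff {φ : K → K} :
    φ ∈ (line K).regular ↔ ∃ P : K[X], ∀ t, φ t = P.eval t := by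
  constructor
  · intro h
    let T : Subalgebra K (K → K) :=
      { carrier := {φ | ∃ P : K[X], ∀ t, φ t = P.eval t}
        mul_mem' := by
          rintro f g ⟨P, hP⟩ ⟨Q, hQ⟩
          exact ⟨P * Q, fun n => by simp [hP, hQ]⟩
        add_mem' := by
          rintro f g ⟨P, hP⟩ ⟨Q, hQ⟩
          exact ⟨P + Q, fun n => by simp [hP, hQ]⟩
        algebraMap_mem' := fun c => ⟨C c, fun n => by simp⟩ }
    have hT : (line K).regular ≤ T := by
      refine Algebra.adjoin_le ?_
      rintro _ ⟨ℓ, rfl⟩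
      refine ⟨C (ℓ 1) * X, fun t => ?_⟩
      rw [eval_mul, eval_C, eval_X, mul_comm, ← smul_eq_mul, ← map_smul, smul_eq_mul, mul_one]
    exact hT h
  · rintro ⟨P, hP⟩
    have : φ = aeval (fun t : K => t) P := by
      ext t
      rw [hP, ← coe_aeval_eq_eval]
      exact (aeval_algHom_apply (Pi.evalAlgHom K (fun _ : K => K) t) (fun t : K => t) P)
    rw [this]
    have := (aeval (⟨_, dual_mem_regular (LinearMap.id : K →ₗ[K] K)⟩ : (line K).regular) P).2
    rwa [← Subalgebra.aeval_coe] at this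

theorem isRegularMap_add_const (s : K) : (line K).IsRegularMap (line K) fun t => s + t :=
  isRegularMap_line_iff.2 (mem_regular_line_iff.2 ⟨C s + X, fun t => by simp⟩)

theorem isRegularMap_mul_const (s : K) : (line K).IsRegularMap (line K) fun t => s * t :=
  isRegularMap_line_iff.2 (mem_regular_line_iff.2 ⟨C s * X, fun t => by simp⟩)

/-- Two curves parametrized by the affine line coincide if they agree at the natural numbers. -/
theorem curve_ext [CharZero K] {γ δ : K → X} (hγ : (line K).IsRegularMap VX γ)
    (hδ : (line K).IsRegularMap VX δ) (h : ∀ n : ℕ, γ n = δ n) (t : K) : γ t = δ t := by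
  refine VX.eq_of_forall_regular fun f hf => ?_
  obtain ⟨P, hP⟩ := mem_regular_line_iff.1 (hγ f hf)
  obtain ⟨Q, hQ⟩ := mem_regular_line_iff.1 (hδ f hf)
  have hPQ : P = Q := by
    refine Polynomial.eq_of_infinite_eval_eq _ _
      ((Set.infinite_range_of_injective (Nat.cast_injective (R := K))).mono ?_)
    rintro _ ⟨n, rfl⟩
    change P.eval _ = Q.eval _
    rw [← hP, ← hQ, Function.comp_apply, Function.comp_apply, h]
  change (f ∘ γ) t = (f ∘ δ) t
  rw [hP, hQ, hPQ]

/-- A sequence of points along which the regular functions are polynomial extends to a curve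
parametrized by the affine line. -/
theorem exists_curve [CharZero K] {x : ℕ → X}
    (h : ∀ f ∈ VX.regular, ∃ P : K[X], ∀ n : ℕ, f (x n) = P.eval (n : K)) :
    ∃ γ : K → X, (line K).IsRegularMap VX γ ∧ ∀ n : ℕ, γ n = x n := by
  choose P hP using fun f : VX.regular => h f.1 f.2
  have huniq : ∀ (f : VX.regular) (Q : K[X]), (∀ n : ℕ, f.1 (x n) = Q.eval (n : K)) → P f = Q := by
    intro f Q hQ
    refine Polynomial.eq_of_infinite_eval_eq _ _
      ((Set.infinite_range_of_injective (Nat.cast_injective (R := K))).mono ?_)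
    rintro _ ⟨n, rfl⟩
    exact (hP f n).symm.trans (hQ n)
  let Φ : VX.regular →ₐ[K] K[X] :=
    { toFun := P
      map_one' := huniq _ _ fun n => by simp
      map_mul' := fun f g => huniq _ _ fun n => by simp [← hP]
      map_zero' := huniq _ _ fun n => by simp
      map_add' := fun f g => huniq _ _ fun n => by simp [← hP]
      commutes' := fun c => huniq _ _ fun n => by simp }
  choose γ hγ using fun t : K => VX.evalAt_bijective.2 ((aeval t).comp Φ)
  have hγP : ∀ (f : VX.regular) t, f.1 (γ t) = (P f).eval t := fun f t => by
    rw [← coe_aeval_eq_eval]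
    exact DFunLike.congr_fun (hγ t) f
  refine ⟨γ, fun f hf => mem_regular_line_iff.2 ⟨P ⟨f, hf⟩, hγP ⟨f, hf⟩⟩, fun n => ?_⟩
  exact VX.eq_of_forall_regular fun f hf => (hγP ⟨f, hf⟩ n).trans (hP ⟨f, hf⟩ n).symm

end Line

section Scalars

variable {K : Type u} [Field K] {A : Type v} [Ring A] {V : AffineVariety K A}

namespace IsAlgebraicRing

variable {X : Type*} {VX : AffineVariety K X} {φ ψ : X → A}

theorem add (hV : V.IsAlgebraicRing) (hφ : VX.IsRegularMap V φ) (hψ : VX.IsRegularMap V ψ) :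
    VX.IsRegularMap V fun x => φ x + ψ x :=
  hV.isRegularMap_add.comp (hφ.prodMk hψ)

theorem mul (hV : V.IsAlgebraicRing) (hφ : VX.IsRegularMap V φ) (hψ : VX.IsRegularMap V ψ) :
    VX.IsRegularMap V fun x => φ x * ψ x :=
  hV.isRegularMap_mul.comp (hφ.prodMk hψ)

end IsAlgebraicRing

/-- A regular map from the field to the center of an algebraic ring that preserves addition and
multiplication, but not necessarily the identity. -/
structure IsScalarCurve (V : AffineVariety K A) (ρ : K → A) : Prop where
  isRegularMap : (line K).IsRegularMap V ρ
  map_add : ∀ s t, ρ (s + t) = ρ s + ρ t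
  map_mul : ∀ s t, ρ (s * t) = ρ s * ρ t
  comm : ∀ t a, ρ t * a = a * ρ t

theorem IsScalarCurve.map_zero {ρ : K → A} (hρ : V.IsScalarCurve ρ) : ρ 0 = 0 := by
  simpa using hρ.map_add 0 0

theorem IsAlgebraicRing.exists_isScalarCurve [IsAlgClosed K] [CharZero K]
    (hV : V.IsAlgebraicRing) :
    ∃ ρ : K → A, V.IsScalarCurve ρ ∧ {a : A | ρ 1 * a = 0}.Finite := by
  obtain ⟨m, hm, hpoly, hfin⟩ := hV.exists_unipotent_multiple
  obtain ⟨γ, hγ, hγn⟩ := exists_curve (x := fun n => ((n * m : ℕ) : A)) hpoly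
  have hmK : (m : K) ≠ 0 := Nat.cast_ne_zero.2 hm.ne'
  have hshift : ∀ s, (line K).IsRegularMap V fun t => γ (s + t) :=
    fun s => hγ.comp (isRegularMap_add_const s)
  have hscale : ∀ s, (line K).IsRegularMap V fun t => γ (s * t) :=
    fun s => hγ.comp (isRegularMap_mul_const s)
  have hadd₀ : ∀ (n : ℕ) t, γ (n + t) = γ n + γ t := fun n =>
    curve_ext (hshift n) (hV.add (.const _) hγ) fun k => by
      rw [← Nat.cast_add, hγn, hγn, hγn, ← Nat.cast_add, add_mul]
  have hadd : ∀ s t, γ (s + t) = γ s + γ t := fun s t => by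
    refine curve_ext (γ := fun s => γ (s + t)) (δ := fun s => γ s + γ t) ?_
      (hV.add hγ (.const _)) (fun n => hadd₀ n t) s
    simpa only [add_comm] using hshift t
  have hmul₀ : ∀ (n : ℕ) t, γ n * γ t = γ (n * m * t) := fun n =>
    curve_ext (hV.mul (.const _) hγ) (hscale (n * m)) fun k => by
      rw [← Nat.cast_mul, ← Nat.cast_mul, hγn, hγn, hγn, ← Nat.cast_mul]
      congr 1
      ring
  have hmul : ∀ s t, γ s * γ t = γ (s * m * t) := fun s t => by
    refine curve_ext (γ := fun s => γ s * γ t) (δ := fun s => γ (s * m * t))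
      (hV.mul hγ (.const _)) ?_ (fun n => hmul₀ n t) s
    have := hscale (m * t)
    simpa only [mul_comm, mul_assoc, mul_left_comm] using this
  have hcomm : ∀ t a, γ t * a = a * γ t := fun t a =>
    curve_ext (γ := fun t => γ t * a) (δ := fun t => a * γ t) (hV.mul hγ (.const _))
      (hV.mul (.const _) hγ) (fun n => by
        rw [hγn]
        exact Nat.cast_commute _ a) t
  refine ⟨fun t => γ ((m : K)⁻¹ * t), ⟨hscale _, fun s t => ?_, fun s t => ?_, fun t a => ?_⟩, ?_⟩
  · rw [mul_add, hadd]
  · rw [hmul]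
    congr 1
    field_simp
  · exact hcomm _ a
  · refine hfin.subset fun a ha => ?_
    have h1 : γ ((m : K)⁻¹ * 1) * (m : A) = (m : A) := by
      have h := hmul ((m : K)⁻¹ * 1) (1 : ℕ)
      have h' := hγn 1
      rw [one_mul] at h'
      rw [← h', h]
      congr 1
      field_simp
    change m • a = 0
    rw [nsmul_eq_mul, ← h1, (Nat.cast_commute m _).eq.symm, mul_assoc,
      show γ ((m : K)⁻¹ * 1) * a = 0 from ha, mul_zero]

end Scalars

section Slope

variable {K : Type u} [Field K]

/-- `φ` is a polynomial function with derivative `c` at the origin. -/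
def HasSlope (φ : K → K) (c : K) : Prop :=
  ∃ P : K[X], (∀ t, φ t = P.eval t) ∧ P.coeff 1 = c

namespace HasSlope

variable {φ ψ : K → K} {c d : K}

theorem unique [CharZero K] (h : HasSlope φ c) (h' : HasSlope φ d) : c = d := by
  obtain ⟨P, hP, rfl⟩ := h
  obtain ⟨Q, hQ, rfl⟩ := h'
  rw [Polynomial.funext fun t => (hP t).symm.trans (hQ t)]

theorem const (a : K) : HasSlope (fun _ => a) 0 :=
  ⟨C a, fun t => by simp, coeff_C_of_ne_zero one_ne_zero⟩

theorem add (h : HasSlope φ c) (h' : HasSlope ψ d) : HasSlope (φ + ψ) (c + d) := by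
  obtain ⟨P, hP, rfl⟩ := h
  obtain ⟨Q, hQ, rfl⟩ := h'
  exact ⟨P + Q, fun t => by simp [hP, hQ], coeff_add _ _ _⟩

theorem mul (h : HasSlope φ c) (h' : HasSlope ψ d) :
    HasSlope (φ * ψ) (c * ψ 0 + φ 0 * d) := by
  obtain ⟨P, hP, rfl⟩ := h
  obtain ⟨Q, hQ, rfl⟩ := h'
  refine ⟨P * Q, fun t => by simp [hP, hQ], ?_⟩
  rw [mul_coeff_one, hP, hQ, ← coeff_zero_eq_eval_zero, ← coeff_zero_eq_eval_zero]
  ring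

theorem scale (h : HasSlope φ c) (s : K) : HasSlope (fun t => φ (s * t)) (s * c) := by
  obtain ⟨P, hP, rfl⟩ := h
  refine ⟨P.comp (C s * X), fun t => by simp [hP], ?_⟩
  rw [comp_C_mul_X_coeff, pow_one, mul_comm]

theorem exists_of_mem_regular (h : φ ∈ (line K).regular) : ∃ c, HasSlope φ c := by
  obtain ⟨P, hP⟩ := mem_regular_line_iff.1 h
  exact ⟨_, P, hP, rfl⟩

/-- A polynomial function all of whose derivatives vanish is constant. -/
theorem eq_of_forall_translate [CharZero K] (h : ∀ s, HasSlope (fun t => φ (s + t)) 0) (t : K) :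
    φ t = φ 0 := by
  obtain ⟨P, hP, -⟩ := h 0
  simp only [zero_add] at hP
  have hder : derivative P = 0 := by
    refine Polynomial.funext fun s => ?_
    rw [eval_zero, ← taylor_coeff_one]
    exact HasSlope.unique ⟨_, fun t => by rw [taylor_eval, add_comm, hP], rfl⟩ (h s)
  rw [hP, hP, eq_C_of_natDegree_eq_zero (derivative_eq_zero.1 hder), eval_C,
    eval_C]

end HasSlope

end Slope

section Tangent

variable {K : Type u} [Field K] {A : Type v} [Ring A] {V : AffineVariety K A} {ρ : K → A}

/-- Along a curve, the derivatives at the origin of a regular function of two variables are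
regular in the second variable. -/
theorem exists_regular_slope {X : Type*} {VX : AffineVariety K X} {F : K × X → K}
    (hF : F ∈ ((line K).prod VX).regular) :
    ∃ g ∈ VX.regular, ∀ x, HasSlope (fun t => F (t, x)) (g x) := by
  let T : Subalgebra K (K × X → K) :=
    { carrier := {F | (∃ f ∈ VX.regular, ∀ x, F (0, x) = f x) ∧
        ∃ g ∈ VX.regular, ∀ x, HasSlope (fun t => F (t, x)) (g x)}
      mul_mem' := by
        rintro F G ⟨⟨f₀, hf₀, hF₀⟩, f₁, hf₁, hF₁⟩ ⟨⟨g₀, hg₀, hG₀⟩, g₁, hg₁, hG₁⟩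
        refine ⟨⟨f₀ * g₀, mul_mem hf₀ hg₀, fun x => by simp [hF₀, hG₀]⟩, f₁ * g₀ + f₀ * g₁,
          add_mem (mul_mem hf₁ hg₀) (mul_mem hf₀ hg₁), fun x => ?_⟩
        have := (hF₁ x).mul (hG₁ x)
        rwa [hF₀, hG₀] at this
      add_mem' := by
        rintro F G ⟨⟨f₀, hf₀, hF₀⟩, f₁, hf₁, hF₁⟩ ⟨⟨g₀, hg₀, hG₀⟩, g₁, hg₁, hG₁⟩
        exact ⟨⟨f₀ + g₀, add_mem hf₀ hg₀, fun x => by simp [hF₀, hG₀]⟩, f₁ + g₁,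
          add_mem hf₁ hg₁, fun x => (hF₁ x).add (hG₁ x)⟩
      algebraMap_mem' := fun c =>
        ⟨⟨fun _ => c, const_mem c, fun _ => rfl⟩, 0, zero_mem _, fun _ => .const c⟩ }
  refine (prod_regular_le (T := T) (fun f hf => ?_) (fun f hf => ?_) hF).2
  · obtain ⟨c, hc⟩ := HasSlope.exists_of_mem_regular hf
    exact ⟨⟨fun _ => f 0, const_mem _, fun _ => rfl⟩, fun _ => c, const_mem _, fun _ => hc⟩
  · exact ⟨⟨f, hf, fun _ => rfl⟩, 0, zero_mem _, fun x => .const (f x)⟩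

/-- The derivative of a function of two variables along a pair of curves is the sum of the partial
derivatives. -/
theorem hasSlope_add_of_prod {X Y : Type*} {VX : AffineVariety K X} {VY : AffineVariety K Y}
    {γ : K → X} {δ : K → Y} (hγ : (line K).IsRegularMap VX γ) (hδ : (line K).IsRegularMap VY δ)
    {F : X × Y → K} (hF : F ∈ (VX.prod VY).regular) :
    ∃ c d, HasSlope (fun t => F (γ t, δ 0)) c ∧ HasSlope (fun t => F (γ 0, δ t)) d ∧
      HasSlope (fun t => F (γ t, δ t)) (c + d) := by
  let T : Subalgebra K (X × Y → K) :=
    { carrier := {F | ∃ c d, HasSlope (fun t => F (γ t, δ 0)) c ∧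
        HasSlope (fun t => F (γ 0, δ t)) d ∧ HasSlope (fun t => F (γ t, δ t)) (c + d)}
      mul_mem' := by
        rintro F G ⟨c, d, h₁, h₂, h₃⟩ ⟨c', d', h₁', h₂', h₃'⟩
        refine ⟨_, _, h₁.mul h₁', h₂.mul h₂', ?_⟩
        have hring : ∀ x y : K, c * y + x * c' + (d * y + x * d') = (c + d) * y + x * (c' + d') :=
          fun x y => by ring
        rw [hring]
        exact h₃.mul h₃'
      add_mem' := by
        rintro F G ⟨c, d, h₁, h₂, h₃⟩ ⟨c', d', h₁', h₂', h₃'⟩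
        refine ⟨_, _, h₁.add h₁', h₂.add h₂', ?_⟩
        rw [add_add_add_comm]
        exact h₃.add h₃'
      algebraMap_mem' := fun c =>
        ⟨0, 0, .const c, .const c, by rw [add_zero]; exact .const c⟩ }
  refine prod_regular_le (T := T) (fun f hf => ?_) (fun f hf => ?_) hF
  · obtain ⟨c, hc⟩ := HasSlope.exists_of_mem_regular (hγ f hf)
    exact ⟨c, 0, hc, .const (f (γ 0)), by rw [add_zero]; exact hc⟩
  · obtain ⟨c, hc⟩ := HasSlope.exists_of_mem_regular (hδ f hf)
    exact ⟨0, c, .const (f (δ 0)), hc, by rw [zero_add]; exact hc⟩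

/-- The tangent vectors at the origin of the curves `t ↦ ρ t * a` are described by finitely many
regular functions of `a`, which are linear and separate the elements of `ρ 1 * A`. -/
theorem IsScalarCurve.exists_tangent [CharZero K] (hV : V.IsAlgebraicRing)
    (hρ : V.IsScalarCurve ρ) :
    ∃ (s : Finset (A → K)) (D : s → A → K), (∀ i, D i ∈ V.regular) ∧
      (∀ i a b, D i (a + b) = D i a + D i b) ∧ (∀ i t a, D i (ρ t * a) = t * D i a) ∧
      ∀ a, (∀ i, D i a = 0) → ρ 1 * a = 0 := by
  have hcurve : ∀ a, (line K).IsRegularMap V fun t => ρ t * a :=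
    fun a => hV.mul hρ.isRegularMap (.const a)
  have hslope : ∀ f : A → K, f ∈ V.regular → ∃ g ∈ V.regular,
      ∀ a, HasSlope (fun t => f (ρ t * a)) (g a) := fun f hf =>
    exists_regular_slope (hV.mul (hρ.isRegularMap.comp .fst) .snd f hf)
  obtain ⟨s, hs⟩ := V.regular_fg
  have hsV : ∀ f ∈ s, f ∈ V.regular := fun f hf => hs ▸ Algebra.subset_adjoin hf
  choose D hD hDs using fun f : s => hslope f.1 (hsV f.1 f.2)
  refine ⟨s, D, hD, fun i a b => ?_, fun i t a => ?_, fun a ha => ?_⟩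
  · obtain ⟨c, d, hc, hd, hcd⟩ := hasSlope_add_of_prod (hcurve a) (hcurve b)
      (hV.isRegularMap_add i.1 (hsV i.1 i.2))
    simp only [Function.comp_apply, hρ.map_zero, zero_mul, zero_add, add_zero, ← mul_add]
      at hc hd hcd
    rw [(hDs i a).unique hc, (hDs i b).unique hd, (hDs i (a + b)).unique hcd]
  · refine (hDs i (ρ t * a)).unique ?_
    have := (hDs i a).scale t
    simpa only [← mul_assoc, ← hρ.map_mul, mul_comm t] using this
  · let T : Subalgebra K (A → K) :=
      { carrier := {f | HasSlope (fun t => f (ρ t * a)) 0}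
        mul_mem' := fun {f g} hf hg => by
          have := HasSlope.mul hf hg
          rwa [zero_mul, mul_zero, add_zero] at this
        add_mem' := fun {f g} hf hg => by
          have := HasSlope.add hf hg
          rwa [add_zero] at this
        algebraMap_mem' := fun c => .const c }
    have hT : V.regular ≤ T := by
      rw [← hs]
      refine Algebra.adjoin_le fun f hf => ?_
      have := hDs ⟨f, hf⟩ a
      rwa [ha] at this
    have hzero : ∀ f ∈ V.regular, f (ρ 1 * a) = f 0 := fun f hf => by
      have := HasSlope.eq_of_forall_translate (φ := fun t => f (ρ t * a)) (fun s => by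
        simp only [hρ.map_add, add_mul]
        exact hT (hV.add (.const (ρ s * a)) .id f hf)) 1
      rwa [hρ.map_zero, zero_mul] at this
    exact V.eq_of_forall_regular hzero

end Tangent

section Embedding

variable {K : Type u} [Field K] {A : Type v} [Ring A] {V : AffineVariety K A} {ρ : K → A}
  {S : Type*} [AddCommGroup S] [Module K S] {i : S →+ A}

/-- A vector space contained in an algebraic ring, with scalar multiplication given by `ρ`, has
finite dimension, and its linear forms are restrictions of regular functions. -/
theorem IsScalarCurve.finiteDimensional [CharZero K] (hV : V.IsAlgebraicRing)
    (hρ : V.IsScalarCurve ρ) (hi : Function.Injective i) (hiρ : ∀ t x, i (t • x) = ρ t * i x) :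
    FiniteDimensional K S ∧
      ∀ ℓ : Module.Dual K S, ∃ g ∈ V.regular, ∀ x, ℓ x = g (i x) := by
  classical
  obtain ⟨s, D, hD, hadd, hsmul, hsep⟩ := hρ.exists_tangent hV
  let L : S →ₗ[K] (s → K) :=
    { toFun := fun x k => D k (i x)
      map_add' := fun x y => funext fun k => by rw [_root_.map_add, hadd, Pi.add_apply]
      map_smul' := fun t x => funext fun k => by
        rw [hiρ, hsmul, RingHom.id_apply, Pi.smul_apply, smul_eq_mul] }
  have hL : Function.Injective L := by
    refine (injective_iff_map_eq_zero L).2 fun x hx => hi ?_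
    rw [_root_.map_zero, ← one_smul K x, hiρ]
    exact hsep _ fun k => congrFun hx k
  have hfin : FiniteDimensional K S := Module.Finite.of_injective L hL
  refine ⟨hfin, fun ℓ => ?_⟩
  obtain ⟨r, hr⟩ := LinearMap.exists_leftInverse_of_injective L (LinearMap.ker_eq_bot.2 hL)
  refine ⟨∑ k, ℓ (r (Pi.single k 1)) • D k,
    sum_mem fun k _ => V.regular.smul_mem (hD k) _, fun x => ?_⟩
  have hx : x = r (L x) := (LinearMap.congr_fun hr x).symm
  conv_lhs => rw [hx, pi_eq_sum_univ' (L x)]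
  simp only [map_sum, map_smul, Finset.sum_apply, Pi.smul_apply, smul_eq_mul]
  exact Finset.sum_congr rfl fun k _ => mul_comm _ _

/-- The inclusion of a finite-dimensional vector space into an algebraic ring is regular if the
scalar multiplication is given by a curve. -/
theorem IsScalarCurve.isRegularMap_inclusion [FiniteDimensional K S] (hV : V.IsAlgebraicRing)
    (hρ : V.IsScalarCurve ρ) (hiρ : ∀ t x, i (t • x) = ρ t * i x) :
    (ofFiniteDimensional K S).IsRegularMap V i := by
  let b := Module.finBasis K S
  have hsum : ∀ s : Finset (Fin (Module.finrank K S)),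
      (ofFiniteDimensional K S).IsRegularMap V fun x => ∑ k ∈ s, ρ (b.coord k x) * i (b k) := by
    intro s
    induction s using Finset.induction_on with
    | empty => simpa using IsRegularMap.const (0 : A)
    | insert k s hk ih =>
      simp only [Finset.sum_insert hk]
      refine hV.add (hV.mul (hρ.isRegularMap.comp ?_) (.const _)) ih
      exact isRegularMap_line_iff.2 (dual_mem_regular (b.coord k))
  convert hsum Finset.univ using 1
  ext x
  conv_lhs => rw [← b.sum_repr x]
  simp only [map_sum, hiρ, Module.Basis.coord_apply]

end Embedding

section Retract

variable {K : Type u} [Field K] {X : Type v} {Y : Type w}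

/-- A retract of an affine variety `X`, with the regular functions of `X` restricted to it. -/
def retract (V : AffineVariety K X) (j : Y → X) (q : X → Y) (hqj : ∀ y, q (j y) = y)
    (hjq : V.IsRegularMap V fun x => j (q x)) : AffineVariety K Y where
  regular := V.regular.map (pullback K j)
  regular_fg := V.regular_fg.map _
  evalAt_bijective := by
    have hmem : ∀ f ∈ V.regular, pullback K j f ∈ V.regular.map (pullback K j) :=
      fun f hf => ⟨f, hf, rfl⟩
    constructor
    · intro y z h
      have hyz : j y = j z :=
        V.eq_of_forall_regular fun f hf => DFunLike.congr_fun h ⟨_, hmem f hf⟩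
      rw [← hqj y, hyz, hqj]
    · intro φ
      obtain ⟨x, hx⟩ := V.evalAt_bijective.2 (φ.comp
        (((pullback K j).comp V.regular.val).codRestrict _ fun f => hmem f.1 f.2))
      have hxφ : ∀ f (hf : f ∈ V.regular), f x = φ ⟨_, hmem f hf⟩ :=
        fun f hf => DFunLike.congr_fun hx ⟨f, hf⟩
      refine ⟨q x, ?_⟩
      ext ⟨_, f, hf, rfl⟩
      refine Eq.trans (?_ : f (j (q x)) = _) (hxφ f hf)
      refine (hxφ _ (hjq f hf)).trans ((congrArg φ (Subtype.ext ?_)).trans (hxφ f hf).symm)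
      ext y
      exact congrArg (fun z => f (j z)) (hqj y)

variable {V : AffineVariety K X} {j : Y → X} {q : X → Y} (hqj : ∀ y, q (j y) = y)
  (hjq : V.IsRegularMap V fun x => j (q x))

theorem isRegularMap_retract_inclusion : (V.retract j q hqj hjq).IsRegularMap V j :=
  fun f hf => ⟨f, hf, rfl⟩

theorem isRegularMap_retraction : V.IsRegularMap (V.retract j q hqj hjq) q := by
  rintro _ ⟨f, hf, rfl⟩
  exact hjq f hf

/-- The structure of an algebraic ring passes to a retract whose operations are induced. -/
theorem IsAlgebraicRing.of_retraction {A : Type v} [Ring A] {V : AffineVariety K A}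
    (hV : V.IsAlgebraicRing) {B : Type w} [Ring B] {W : AffineVariety K B} {j : B → A} {q : A → B}
    (hj : W.IsRegularMap V j) (hq : V.IsRegularMap W q)
    (hadd : ∀ x y, q (j x + j y) = x + y) (hneg : ∀ x, q (-j x) = -x)
    (hmul : ∀ x y, q (j x * j y) = x * y) : W.IsAlgebraicRing where
  isRegularMap_add := by
    simpa only [hadd] using hq.comp (hV.add (hj.comp .fst) (hj.comp .snd))
  isRegularMap_neg := by
    simpa only [hneg] using hq.comp (hV.isRegularMap_neg.comp hj)
  isRegularMap_mul := by
    simpa only [hmul] using hq.comp (hV.mul (hj.comp .fst) (hj.comp .snd))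

end Retract

section Corner

variable {A : Type v} [Ring A] {e : A}

/-- The projection of a ring onto the corner of a central idempotent. -/
def cornerProj (he : IsIdempotentElem e) (a : A) : he.Corner := ⟨e * a * e, a, rfl⟩

/-- The inclusion of a corner into the ring. -/
def cornerIncl (he : IsIdempotentElem e) : he.Corner →+ A where
  toFun x := x.1
  map_zero' := rfl
  map_add' _ _ := rfl

theorem cornerIncl_injective (he : IsIdempotentElem e) : Function.Injective (cornerIncl he) :=
  Subtype.val_injective

variable (he : IsIdempotentElem e)

theorem cornerIncl_mul (x y : he.Corner) :
    cornerIncl he (x * y) = cornerIncl he x * cornerIncl he y := rfl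

theorem cornerIncl_one : cornerIncl he 1 = e := rfl

theorem mul_cornerIncl (x : he.Corner) : e * cornerIncl he x = cornerIncl he x :=
  ((Subsemigroup.mem_corner_iff he).1 x.2).1

theorem cornerIncl_cornerProj (hc : ∀ a, e * a = a * e) (a : A) :
    cornerIncl he (cornerProj he a) = e * a := by
  change e * a * e = e * a
  rw [mul_assoc, ← hc, ← mul_assoc, he.eq]

theorem cornerProj_cornerIncl (x : he.Corner) : cornerProj he (cornerIncl he x) = x := by
  refine Subtype.ext ?_
  have h := (Subsemigroup.mem_corner_iff he).1 x.2
  change e * x.1 * e = x.1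
  rw [h.1, h.2]

/-- A central idempotent decomposes a ring into a product. -/
def ringEquivCorners (he : IsIdempotentElem e) (hc : ∀ a, e * a = a * e) :
    A ≃+* he.Corner × he.one_sub.Corner :=
  have hc' : ∀ a, (1 - e) * a = a * (1 - e) := fun a => by rw [sub_mul, mul_sub, hc]; simp
  have h0 : e * (1 - e) = 0 := by rw [mul_sub, he.eq, mul_one, sub_self]
  have h0' : (1 - e) * e = 0 := by rw [sub_mul, he.eq, one_mul, sub_self]
  { toFun := fun a => (cornerProj he a, cornerProj he.one_sub a)
    invFun := fun p => cornerIncl he p.1 + cornerIncl he.one_sub p.2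
    left_inv := fun a => by
      simp only [cornerIncl_cornerProj he hc, cornerIncl_cornerProj he.one_sub hc']
      rw [← add_mul, add_sub_cancel, one_mul]
    right_inv := fun p => by
      refine Prod.ext (cornerIncl_injective he ?_) (cornerIncl_injective he.one_sub ?_)
      · rw [cornerIncl_cornerProj he hc, mul_add, mul_cornerIncl,
          ← mul_cornerIncl he.one_sub p.2, ← mul_assoc, h0, zero_mul, add_zero]
      · rw [cornerIncl_cornerProj he.one_sub hc', mul_add, mul_cornerIncl,
          ← mul_cornerIncl he p.1, ← mul_assoc, h0', zero_mul, zero_add]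
    map_mul' := fun a b => by
      refine Prod.ext (cornerIncl_injective he ?_) (cornerIncl_injective he.one_sub ?_)
      · rw [Prod.fst_mul, cornerIncl_mul]
        simp only [cornerIncl_cornerProj he hc]
        rw [mul_assoc, ← mul_assoc a, ← hc a, ← mul_assoc, ← mul_assoc, ← mul_assoc, he.eq]
      · rw [Prod.snd_mul, cornerIncl_mul]
        simp only [cornerIncl_cornerProj he.one_sub hc']
        rw [mul_assoc, ← mul_assoc a, ← hc' a, ← mul_assoc, ← mul_assoc, ← mul_assoc,
          he.one_sub.eq]
    map_add' := fun a b => by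
      refine Prod.ext (cornerIncl_injective he ?_) (cornerIncl_injective he.one_sub ?_)
      · rw [Prod.fst_add, _root_.map_add]
        simp only [cornerIncl_cornerProj he hc, mul_add]
      · rw [Prod.snd_add, _root_.map_add]
        simp only [cornerIncl_cornerProj he.one_sub hc', mul_add] }

variable {K : Type u} [Field K] {V : AffineVariety K A} {ρ : K → A}

/-- The curve of scalars as a ring homomorphism to the corner of its value at `1`. -/
def IsScalarCurve.toCorner (hρ : V.IsScalarCurve ρ) (he : IsIdempotentElem (ρ 1)) :
    K →+* he.Corner where
  toFun t := cornerProj he (ρ t)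
  map_one' := cornerIncl_injective he (by
    rw [cornerIncl_cornerProj he (hρ.comm 1), cornerIncl_one, he.eq])
  map_mul' s t := cornerIncl_injective he (by
    simp only [cornerIncl_mul, cornerIncl_cornerProj he (hρ.comm 1), ← hρ.map_mul, one_mul])
  map_zero' := cornerIncl_injective he (by
    rw [cornerIncl_cornerProj he (hρ.comm 1), hρ.map_zero, mul_zero, _root_.map_zero])
  map_add' s t := cornerIncl_injective he (by
    simp only [_root_.map_add, cornerIncl_cornerProj he (hρ.comm 1), hρ.map_add, mul_add])

theorem IsScalarCurve.cornerIncl_toCorner (hρ : V.IsScalarCurve ρ) (he : IsIdempotentElem (ρ 1))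
    (t : K) : cornerIncl he (hρ.toCorner he t) = ρ t :=
  (cornerIncl_cornerProj he (hρ.comm 1) _).trans (by rw [← hρ.map_mul, one_mul])

/-- The corner of the value at `1` of a curve of scalars is an algebra. -/
abbrev IsScalarCurve.cornerAlgebra (hρ : V.IsScalarCurve ρ) (he : IsIdempotentElem (ρ 1)) :
    Algebra K he.Corner :=
  (hρ.toCorner he).toAlgebra' fun t x => cornerIncl_injective he (by
    rw [cornerIncl_mul, cornerIncl_mul, hρ.cornerIncl_toCorner, hρ.comm])

end Corner

theorem IsAlgebraicRing.virtuallyComesFromAlgebra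
    {K : Type u} [Field K] [IsAlgClosed K] [CharZero K] {A : Type v} [Ring A]
    {V : AffineVariety K A} (hV : V.IsAlgebraicRing) : V.VirtuallyComesFromAlgebra := by
  obtain ⟨ρ, hρ, hfinite⟩ := hV.exists_isScalarCurve
  have he : IsIdempotentElem (ρ 1) := by rw [IsIdempotentElem, ← hρ.map_mul, one_mul]
  have hc : ∀ a, (1 - ρ 1) * a = a * (1 - ρ 1) := fun a => by
    rw [sub_mul, mul_sub, hρ.comm, one_mul, mul_one]
  let alg : Algebra K he.Corner := hρ.cornerAlgebra he
  have hsmul : ∀ (t : K) (x : he.Corner), cornerIncl he (t • x) = ρ t * cornerIncl he x :=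
    fun t x => by
      rw [Algebra.smul_def, cornerIncl_mul]
      exact congrArg (· * _) (hρ.cornerIncl_toCorner he t)
  obtain ⟨hfd, hdual⟩ := hρ.finiteDimensional hV (cornerIncl_injective he) hsmul
  have hi := hρ.isRegularMap_inclusion (i := cornerIncl he) hV hsmul
  have hp : V.IsRegularMap (ofFiniteDimensional K he.Corner) (cornerProj he) := by
    refine isRegularMap_ofFiniteDimensional fun ℓ => ?_
    obtain ⟨g, hg, hℓ⟩ := hdual ℓ
    simp only [hℓ, cornerIncl_cornerProj he (hρ.comm 1)]
    exact hV.mul (.const (ρ 1)) .id g hg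
  have hjq : V.IsRegularMap V fun a => cornerIncl he.one_sub (cornerProj he.one_sub a) := by
    simp only [cornerIncl_cornerProj he.one_sub hc]
    exact hV.mul (.const (1 - ρ 1)) .id
  let W := V.retract _ _ (cornerProj_cornerIncl he.one_sub) hjq
  have hj : W.IsRegularMap V (cornerIncl he.one_sub) := isRegularMap_retract_inclusion _ _
  have hq : V.IsRegularMap W (cornerProj he.one_sub) := isRegularMap_retraction _ _
  have hS : (ofFiniteDimensional K he.Corner).IsAlgebraicRing := hV.of_retraction hi hp
    (fun x y => by rw [← _root_.map_add, cornerProj_cornerIncl])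
    (fun x => by rw [← map_neg, cornerProj_cornerIncl])
    (fun x y => by rw [← cornerIncl_mul, cornerProj_cornerIncl])
  have hC : W.IsAlgebraicRing := hV.of_retraction hj hq
    (fun x y => by rw [← _root_.map_add, cornerProj_cornerIncl])
    (fun x => by rw [← map_neg, cornerProj_cornerIncl])
    (fun x y => by rw [← cornerIncl_mul, cornerProj_cornerIncl])
  refine ⟨he.Corner, inferInstance, ofFiniteDimensional K he.Corner, he.one_sub.Corner,
    inferInstance, W, hS, hC, ⟨he.Corner, inferInstance, alg, hfd, RingEquiv.refl _,
    fun f hf => hf, fun f hf => hf⟩, ?_, ringEquivCorners he (hρ.comm 1), hp.prodMk hq,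
    hV.add (hi.comp .fst) (hj.comp .snd)⟩
  have := hfinite.to_subtype
  refine Finite.of_injective
    (fun x : he.one_sub.Corner => (⟨cornerIncl he.one_sub x, ?_⟩ : {a : A | ρ 1 * a = 0})) ?_
  · have h := mul_cornerIncl he.one_sub x
    rwa [sub_mul, one_mul, sub_eq_self] at h
  · exact fun x y h => cornerIncl_injective he.one_sub (Subtype.mk.inj h)

end AffineVariety

/-- Over an algebraically closed field of characteristic zero, each algebraic ring virtually comes
from an algebra. -/
theorem propositionP {K : Type u} [Field K] [IsAlgClosed K] [CharZero K] {A : Type v} [Ring A]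
    (V : AffineVariety K A) (hV : V.IsAlgebraicRing) : V.VirtuallyComesFromAlgebra :=
  hV.virtuallyComesFromAlgebra
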